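/- Let $K$ be a field (for instance $\mathbb{R}$, $\mathbb{C}$ or a field of rational functions $\mathbb{Q}(q,s)$), and let $q \in K$ be non-zero and not a root of unity (for instance a real $q$ with $0<|q|<1$, or an indeterminate). For $x\in K$ and integers $n\ge 0$, $0\le k\le n$ write $$(x;q)_n=\prod_{j=0}^{n-1}(1-q^jx),\qquad \begin{bmatrix} n\\ k\end{bmatrix}_q=\prod_{j=0}^{k-1}\frac{1-q^{n-j}}{1-q^{k-j}},$$ and for $s \in K$ let $$f(n,s,q)=\frac{1}{(-q;q)_n}\sum_{j=0}^n s^j\begin{bmatrix} n\\ j\end{bmatrix}_{q^2},\qquad d(n,s,q)=\det\bigl(f(i+j,s,q)\bigr)_{i,j=0}^n .$$ Then for every integer $n\ge 0$ and every $s \in K$ $$d(n,s,q)=q^{\frac{n^2(n+1)}{2}}\,\frac{\prod_{j=0}^n\left(\frac{s}{q^{2j-1}};q^2\right)_{2j}\,\prod_{j=0}^n(q;q)_j}{\prod_{j=0}^n(-q;q)_{j+n}} .$$ Moreover, the zeros of $d(n,s,q)$ in $s$ are exactly the elements $q^{\pm(2m+1)}$ with $0\le m\le n-1$. -/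

import Mathlib

/-- The `q`-Pochhammer symbol `(x; q)_n = ∏_{j=0}^{n-1} (1 - q^j x)`. -/
def qPoch {K : Type*} [Field K] (x q : K) (n : ℕ) : K :=
  ∏ j ∈ Finset.range n, (1 - q ^ j * x)

/-- The `q`-binomial coefficient
`[n, k]_q = ∏_{j=0}^{k-1} (1 - q^(n-j)) / ∏_{j=0}^{k-1} (1 - q^(k-j))`.
For `k > n` the factor `j = n` of the numerator is `0`, so the truncated subtraction is harmless. -/
def qBinom {K : Type*} [Field K] (q : K) (n k : ℕ) : K :=
  (∏ j ∈ Finset.range k, (1 - q ^ (n - j))) / ∏ j ∈ Finset.range k, (1 - q ^ (k - j))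

/-- The Rogers-Szegő polynomial `r_n(s, q) = ∑_{j=0}^n [n, j]_q s^j`. -/
def rogersSzego {K : Type*} [Field K] (n : ℕ) (s q : K) : K :=
  ∑ j ∈ Finset.range (n + 1), qBinom q n j * s ^ j

/-- The normalized Rogers-Szegő polynomial `f(n, s, q) = r_n(s, q^2) / (-q; q)_n`. -/
def normRogersSzego {K : Type*} [Field K] (n : ℕ) (s q : K) : K :=
  rogersSzego n s (q ^ 2) / qPoch (-q) q n

/-- The Hankel determinant `d(n, s, q) = det (f(i+j, s, q))_{i,j=0}^n`, of size `n + 1`. -/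
def hankelDet {K : Type*} [Field K] (n : ℕ) (s q : K) : K :=
  Matrix.det (Matrix.of fun i j : Fin (n + 1) =>
    normRogersSzego ((i : ℕ) + (j : ℕ)) s q)

/-! ### Three-term recurrences for the Rogers-Szegő polynomials and the moments -/

section QBinomial

variable {K : Type*} [Field K]

/-! Let `L` be the linear functional on `K[X]` with moments `f(n, s, q)`. The recurrence of the
moments is a `q`-difference equation for `L`. If `s = t^2` and `q = r^2`, this equation evaluates
`L` on products of u_k = ∏_{j<k} (t - r q^j X) and v_m = ∏_{j<m} (t + r q^j X):
`momentFunctional_linProd_mul` gives L(u_k v_m) = a_k b_m / (-q;q)_{k+m}.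

Passing from monomials to the u_i (rows) and v_j (columns) multiplies the Hankel determinant by
leading coefficients (`det_momentFunctional_mul`). What remains, up to diagonal factors, is the
matrix 1/(-q;q)_{i+j}, which reduces to a Vandermonde determinant (`det_inv_qPoch_neg_self`). The
square roots exist in an algebraic closure, and the identity descends to `K`. -/

lemma qPoch_succ (x q : K) (n : ℕ) : qPoch x q (n + 1) = qPoch x q n * (1 - q ^ n * x) :=
  Finset.prod_range_succ _ _

lemma qBinom_zero_right (q : K) (n : ℕ) : qBinom q n 0 = 1 := by simp [qBinom]

lemma qBinom_eq_zero_of_lt (q : K) {n k : ℕ} (h : n < k) : qBinom q n k = 0 := by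
  unfold qBinom
  rw [Finset.prod_eq_zero (Finset.mem_range.2 h) (by simp), zero_div]

lemma prod_one_sub_pow_tsub (q : K) (k : ℕ) :
    ∏ j ∈ Finset.range k, (1 - q ^ (k - j)) = qPoch q q k := by
  rw [← Finset.prod_range_reflect, qPoch]
  refine Finset.prod_congr rfl fun j hj => ?_
  have := Finset.mem_range.1 hj
  rw [show k - (k - 1 - j) = j + 1 by omega, pow_succ]

lemma qPoch_self_ne_zero {q : K} (hq : ∀ k : ℕ, 0 < k → q ^ k ≠ 1) (k : ℕ) :
    qPoch q q k ≠ 0 := by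
  refine Finset.prod_ne_zero_iff.2 fun j _ h => hq (j + 1) j.succ_pos ?_
  rw [pow_succ]
  exact (sub_eq_zero.1 h).symm

lemma one_add_pow_ne_zero {q : K} (hq : ∀ k : ℕ, 0 < k → q ^ k ≠ 1) {k : ℕ} (hk : 0 < k) :
    1 + q ^ k ≠ 0 := fun h =>
  hq (k * 2) (by omega) (by rw [pow_mul, eq_neg_of_add_eq_zero_right h]; ring)

lemma qPoch_neg_self_ne_zero {q : K} (hq : ∀ k : ℕ, 0 < k → q ^ k ≠ 1) (k : ℕ) :
    qPoch (-q) q k ≠ 0 := by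
  refine Finset.prod_ne_zero_iff.2 fun j _ => ?_
  have := one_add_pow_ne_zero hq j.succ_pos
  rwa [show 1 - q ^ j * -q = 1 + q ^ (j + 1) by ring]

lemma qBinom_succ_right_mul {q : K} (hq : ∀ k : ℕ, 0 < k → q ^ k ≠ 1) (n j : ℕ) :
    qBinom q n (j + 1) * (1 - q ^ (j + 1)) = qBinom q n j * (1 - q ^ (n - j)) := by
  have h1 := qPoch_self_ne_zero hq j
  have h2 := qPoch_self_ne_zero hq (j + 1)
  unfold qBinom
  rw [prod_one_sub_pow_tsub, prod_one_sub_pow_tsub, Finset.prod_range_succ]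
  rw [qPoch_succ, ← pow_succ] at *
  have h3 := right_ne_zero_of_mul h2
  field_simp

lemma qBinom_succ_left_mul (q : K) (n j : ℕ) :
    qBinom q (n + 1) j * (1 - q ^ (n + 1 - j)) = (1 - q ^ (n + 1)) * qBinom q n j := by
  unfold qBinom
  rw [div_mul_eq_mul_div, ← Finset.prod_range_succ (fun j => 1 - q ^ (n + 1 - j)),
    Finset.prod_range_succ', mul_div_assoc', mul_comm (1 - q ^ (n + 1))]
  simp

/-- The combination of the two `q`-Pascal rules behind the Rogers-Szegő recurrence. -/
lemma qBinom_succ_succ {q : K} (hq : ∀ k : ℕ, 0 < k → q ^ k ≠ 1) {n j : ℕ} (hj : j ≤ n + 1) :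
    qBinom q (n + 2) (j + 1) =
      qBinom q (n + 1) (j + 1) + qBinom q (n + 1) j - (1 - q ^ (n + 1)) * qBinom q n j := by
  have h0 : 1 - q ^ (j + 1) ≠ 0 := fun h => hq _ j.succ_pos (sub_eq_zero.1 h).symm
  have h1 := qBinom_succ_right_mul hq (n + 2) j
  have h2 := qBinom_succ_right_mul hq (n + 1) j
  have h3 := qBinom_succ_left_mul q (n + 1) j
  have h4 := qBinom_succ_left_mul q n j
  have h5 : q ^ (n + 1 + 1) = q ^ (n + 1 - j) * q ^ (j + 1) := by
    rw [← pow_add]; congr 1; omega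
  apply mul_right_cancel₀ h0
  rw [h5] at h3
  linear_combination h1 + h3 - h2 - (1 - q ^ (j + 1)) * h4

lemma rogersSzego_zero (s q : K) : rogersSzego 0 s q = 1 := by
  simp [rogersSzego, qBinom_zero_right]

lemma rogersSzego_one {q : K} (hq : ∀ k : ℕ, 0 < k → q ^ k ≠ 1) (s : K) :
    rogersSzego 1 s q = 1 + s := by
  have h0 : 1 - q ≠ 0 := fun h => hq 1 one_pos (by rw [pow_one]; exact (sub_eq_zero.1 h).symm)
  simp [rogersSzego, Finset.sum_range_succ, qBinom, h0]

lemma rogersSzego_add_two {q : K} (hq : ∀ k : ℕ, 0 < k → q ^ k ≠ 1) (n : ℕ) (s : K) :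
    rogersSzego (n + 2) s q =
      (1 + s) * rogersSzego (n + 1) s q - s * (1 - q ^ (n + 1)) * rogersSzego n s q := by
  -- All sums are padded with vanishing terms to one common range, so that they can be compared
  -- termwise.
  have e1 : rogersSzego (n + 1) s q =
      ∑ j ∈ Finset.range (n + 2), qBinom q (n + 1) (j + 1) * s ^ (j + 1) + 1 := by
    have : rogersSzego (n + 1) s q =
        ∑ j ∈ Finset.range (n + 3), qBinom q (n + 1) j * s ^ j := by
      rw [Finset.sum_range_succ, qBinom_eq_zero_of_lt q (Nat.lt_succ_self (n + 1))]
      simp [rogersSzego]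
    rw [this, Finset.sum_range_succ']
    simp [qBinom_zero_right]
  have e0 : rogersSzego n s q = ∑ j ∈ Finset.range (n + 2), qBinom q n j * s ^ j := by
    rw [Finset.sum_range_succ, qBinom_eq_zero_of_lt q (Nat.lt_succ_self n)]
    simp [rogersSzego]
  have e1' : rogersSzego (n + 1) s q =
      ∑ j ∈ Finset.range (n + 2), qBinom q (n + 1) j * s ^ j := rfl
  have e2 : rogersSzego (n + 2) s q =
      ∑ j ∈ Finset.range (n + 2), qBinom q (n + 2) (j + 1) * s ^ (j + 1) + 1 := by
    rw [rogersSzego, Finset.sum_range_succ']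
    simp [qBinom_zero_right]
  have key : ∑ j ∈ Finset.range (n + 2), qBinom q (n + 2) (j + 1) * s ^ (j + 1) =
      ∑ j ∈ Finset.range (n + 2), qBinom q (n + 1) (j + 1) * s ^ (j + 1) +
      s * ∑ j ∈ Finset.range (n + 2), qBinom q (n + 1) j * s ^ j -
      s * (1 - q ^ (n + 1)) * ∑ j ∈ Finset.range (n + 2), qBinom q n j * s ^ j := by
    rw [Finset.mul_sum, Finset.mul_sum, ← Finset.sum_add_distrib, ← Finset.sum_sub_distrib]
    refine Finset.sum_congr rfl fun j hj => ?_
    rw [qBinom_succ_succ hq (by have := Finset.mem_range.1 hj; omega)]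
    ring
  rw [← e1', ← e0] at key
  linear_combination e2 + key - e1

lemma sq_pow_ne_one {q : K} (hq : ∀ k : ℕ, 0 < k → q ^ k ≠ 1) (k : ℕ) (hk : 0 < k) :
    (q ^ 2) ^ k ≠ 1 := by
  rw [← pow_mul]
  exact hq _ (by omega)

lemma normRogersSzego_zero (s q : K) : normRogersSzego 0 s q = 1 := by
  simp [normRogersSzego, rogersSzego_zero, qPoch]

lemma normRogersSzego_one {q : K} (hq : ∀ k : ℕ, 0 < k → q ^ k ≠ 1) (s : K) :
    normRogersSzego 1 s q = (1 + s) / (1 + q) := by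
  simp [normRogersSzego, rogersSzego_one (sq_pow_ne_one hq), qPoch]

lemma normRogersSzego_add_two {q : K} (hq : ∀ k : ℕ, 0 < k → q ^ k ≠ 1) (n : ℕ) (s : K) :
    (1 + q ^ (n + 2)) * normRogersSzego (n + 2) s q =
      (1 + s) * normRogersSzego (n + 1) s q -
        s * (1 - q ^ (n + 1)) * normRogersSzego n s q := by
  have h0 := qPoch_neg_self_ne_zero hq n
  have h1 := one_add_pow_ne_zero hq n.succ_pos
  have h2 := one_add_pow_ne_zero hq (n + 1).succ_pos
  simp only [Nat.succ_eq_add_one] at h1 h2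
  have e1 : qPoch (-q) q (n + 1) = qPoch (-q) q n * (1 + q ^ (n + 1)) := by
    rw [qPoch_succ]; ring
  have e2 : qPoch (-q) q (n + 2) = qPoch (-q) q n * (1 + q ^ (n + 1)) * (1 + q ^ (n + 2)) := by
    rw [qPoch_succ, e1]; ring
  have e3 : (q ^ 2) ^ (n + 1) = (q ^ (n + 1)) ^ 2 := by ring
  unfold normRogersSzego
  rw [e1, e2, rogersSzego_add_two (sq_pow_ne_one hq), e3]
  generalize q ^ (n + 1) = a at *
  generalize q ^ (n + 1 + 1) = b at *
  change 1 + b ≠ 0 at h2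
  field_simp
  ring

end QBinomial

/-! ### The moment functional and its q-difference equation -/

section MomentFunctional

open Polynomial

variable {K : Type*} [Field K]

/-- The linear functional on polynomials with moments `f`. -/
noncomputable def momentFunctional (f : ℕ → K) : K[X] →ₗ[K] K :=
  Polynomial.lsum fun n => f n • LinearMap.id

lemma momentFunctional_monomial (f : ℕ → K) (n : ℕ) (a : K) :
    momentFunctional f (monomial n a) = f n * a := by
  simp [momentFunctional, Polynomial.lsum, Polynomial.sum_monomial_index]

lemma momentFunctional_C_mul (f : ℕ → K) (a : K) (p : K[X]) :
    momentFunctional f (C a * p) = a * momentFunctional f p := by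
  rw [← smul_eq_C_mul, map_smul, smul_eq_mul]

lemma momentFunctional_mul_eq_sum (f : ℕ → K) {p r : K[X]} {m n : ℕ}
    (hp : p.natDegree < m) (hr : r.natDegree < n) :
    momentFunctional f (p * r) =
      ∑ k ∈ Finset.range m, ∑ l ∈ Finset.range n, p.coeff k * f (k + l) * r.coeff l := by
  conv_lhs => rw [p.as_sum_range' m hp, r.as_sum_range' n hr]
  rw [Finset.sum_mul_sum]
  simp only [map_sum, monomial_mul_monomial, momentFunctional_monomial]
  refine Finset.sum_congr rfl fun k _ => Finset.sum_congr rfl fun l _ => by ring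

/-- The `q`-difference equation encoding the three-term recurrence of the moments. -/
lemma momentFunctional_normRogersSzego_divX {q : K} (hq : ∀ k : ℕ, 0 < k → q ^ k ≠ 1) (s : K)
    (p : K[X]) :
    momentFunctional (normRogersSzego · s q) (X * p) +
      q * momentFunctional (normRogersSzego · s q) (X * p.comp (C q * X)) -
      (1 + s) * momentFunctional (normRogersSzego · s q) p +
      s * momentFunctional (normRogersSzego · s q) (p - p.comp (C q * X)).divX = 0 := by
  induction p using Polynomial.induction_on' with
  | add p r hp hr =>
    rw [add_comp, mul_add, mul_add,
      show p + r - (p.comp (C q * X) + r.comp (C q * X)) =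
        (p - p.comp (C q * X)) + (r - r.comp (C q * X)) by ring, divX_add]
    simp only [map_add]
    linear_combination hp + hr
  | monomial n a =>
    have e : (monomial n a).comp (C q * X) = monomial n (a * q ^ n) := by
      rw [monomial_comp, mul_pow, ← C_pow, ← mul_assoc, ← C_mul, C_mul_X_pow_eq_monomial]
    rw [e, ← map_sub, X_mul_monomial, X_mul_monomial]
    simp only [momentFunctional_monomial]
    cases n with
    | zero =>
      have h1 : 1 + q ≠ 0 := by simpa using one_add_pow_ne_zero hq one_pos
      simp only [pow_zero, mul_one, sub_self, map_zero, divX_zero, zero_add,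
        normRogersSzego_zero, normRogersSzego_one hq]
      field_simp
      ring
    | succ n =>
      have h : (monomial (n + 1) (a - a * q ^ (n + 1))).divX =
          monomial n (a - a * q ^ (n + 1)) := by
        ext k
        simp [coeff_monomial]
      rw [h, momentFunctional_monomial]
      linear_combination a * normRogersSzego_add_two hq n s

lemma momentFunctional_normRogersSzego_eq {q : K} (hq : ∀ k : ℕ, 0 < k → q ^ k ≠ 1) (s : K)
    {p w : K[X]} (h : p - p.comp (C q * X) = X * w) :
    momentFunctional (normRogersSzego · s q) (X * p) +
      q * momentFunctional (normRogersSzego · s q) (X * p.comp (C q * X)) -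
      (1 + s) * momentFunctional (normRogersSzego · s q) p +
      s * momentFunctional (normRogersSzego · s q) w = 0 := by
  have := momentFunctional_normRogersSzego_divX hq s p
  rwa [h, show divX (X * w) = w by ext k; simp] at this

end MomentFunctional

/-! ### Moments of the product bases -/

section MixedMoments

open Polynomial

variable {K : Type*} [Field K]

/-- The polynomial `∏_{j<k} (t - r q^j X)`. -/
noncomputable def linProd (t r q : K) (k : ℕ) : K[X] :=
  ∏ j ∈ Finset.range k, (C t - C (r * q ^ j) * X)

lemma linProd_zero (t r q : K) : linProd t r q 0 = 1 := rfl

lemma linProd_succ (t r q : K) (k : ℕ) :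
    linProd t r q (k + 1) = linProd t r q k * (C t - C (r * q ^ k) * X) :=
  Finset.prod_range_succ _ _

/-- Substituting `q X` shifts `j` to `j + 1` in each factor, and the extra factor supplies the
missing `j = 0`. Hence p = (tq - rX) u_k and p(qX) are both multiples of u_k, which makes p the
right test polynomial for the `q`-difference equation. -/
lemma linProd_comp (t r q : K) (k : ℕ) :
    ((C (t * q) - C r * X) * linProd t r q k).comp (C q * X) =
      C q * linProd t r q (k + 1) := by
  rw [mul_comp, linProd, prod_comp, linProd, Finset.prod_range_succ', mul_left_comm, mul_comm]
  congr 1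
  · refine Finset.prod_congr rfl fun j _ => ?_
    simp only [sub_comp, mul_comp, C_comp, X_comp]
    rw [pow_succ, ← mul_assoc r, C_mul (a := r * q ^ j)]
    ring
  · simp only [sub_comp, mul_comp, C_comp, X_comp, C_mul, pow_zero, C_1]
    ring

/-- The three-term relation determining the moments `L (linProd t r q k)`. -/
lemma momentFunctional_linProd_relation {q t r : K} (hq : ∀ k : ℕ, 0 < k → q ^ k ≠ 1)
    (k : ℕ) :
    let L := momentFunctional (normRogersSzego · (t ^ 2) q)
    let u := linProd t r q k
    (t * q + t * q ^ 2 + (1 + t ^ 2) * r) * L (X * u) - r * (1 + q ^ (k + 2)) * L (X ^ 2 * u) -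
      ((1 + t ^ 2) * (t * q) + t ^ 2 * r * (1 - q ^ (k + 1))) * L u = 0 := by
  intro L u
  have hw : (C (t * q) - C r * X) * u - ((C (t * q) - C r * X) * u).comp (C q * X) =
      X * (C (r * q ^ (k + 1) - r) * u) := by
    rw [linProd_comp, linProd_succ]
    simp only [C_mul, C_sub, C_pow]
    ring
  have h := momentFunctional_normRogersSzego_eq hq (t ^ 2) hw
  rw [linProd_comp, linProd_succ] at h
  have e1 : X * ((C (t * q) - C r * X) * u) = C (t * q) * (X * u) - C r * (X ^ 2 * u) := by ring
  have e2 : X * (C q * (u * (C t - C (r * q ^ k) * X))) =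
      C (q * t) * (X * u) - C (q * (r * q ^ k)) * (X ^ 2 * u) := by
    simp only [C_mul]; ring
  have e3 : (C (t * q) - C r * X) * u = C (t * q) * u - C r * (X * u) := by ring
  change L _ + q * L _ - _ * L _ + _ * L _ = 0 at h
  have hL : ∀ a p, L (C a * p) = a * L p := momentFunctional_C_mul _
  rw [e1, e2, e3] at h
  rw [map_sub, map_sub, map_sub, hL, hL, hL, hL, hL, hL, hL] at h
  linear_combination h

/-- L(u_{k+1}) and L(u_{k+2}) are combinations of L(u_k), L(X u_k), L(X² u_k), which satisfy one
linear relation; this forces a two-step recursion. -/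
lemma momentFunctional_linProd {q t r : K} (hq0 : q ≠ 0) (hq : ∀ k : ℕ, 0 < k → q ^ k ≠ 1)
    (hr : r ^ 2 = q) (k : ℕ) :
    momentFunctional (normRogersSzego · (t ^ 2) q) (linProd t r q k) =
      qPoch (t * r) q k * (∏ j ∈ Finset.range k, (t - r * q ^ j)) / qPoch (-q) q k := by
  set L := momentFunctional (normRogersSzego · (t ^ 2) q) with hLdef
  have hL : ∀ a p, L (C a * p) = a * L p := momentFunctional_C_mul _
  have hr0 : r ≠ 0 := by rintro rfl; simp at hr; exact hq0 hr.symm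
  induction k using Nat.twoStepInduction with
  | zero =>
    have := momentFunctional_monomial (normRogersSzego · (t ^ 2) q) 0 1
    simpa [linProd_zero, qPoch, hLdef, normRogersSzego_zero] using this
  | one =>
    have h0 := momentFunctional_monomial (normRogersSzego · (t ^ 2) q) 0 t
    have h1 := momentFunctional_monomial (normRogersSzego · (t ^ 2) q) 1 r
    rw [← C_mul_X_pow_eq_monomial, normRogersSzego_one hq] at h1
    rw [← C_mul_X_pow_eq_monomial, normRogersSzego_zero] at h0
    simp only [pow_zero, mul_one, pow_one, one_mul] at h0 h1
    have h2 : 1 + q ≠ 0 := by simpa using one_add_pow_ne_zero hq one_pos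
    simp only [linProd, Finset.prod_range_one, pow_zero, mul_one, map_sub, qPoch, hLdef, h0, h1]
    rw [show 1 - 1 * -q = 1 + q by ring]
    field_simp
    rw [← hr]
    ring
  | more k ih0 ih1 =>
    have hrel := momentFunctional_linProd_relation (t := t) (r := r) hq k
    have e1 : linProd t r q (k + 1) =
        C t * linProd t r q k - C (r * q ^ k) * (X * linProd t r q k) := by
      rw [linProd_succ]; ring
    have e2 : linProd t r q (k + 2) = C (t ^ 2) * linProd t r q k
        - C (t * r * (q ^ k + q ^ (k + 1))) * (X * linProd t r q k)
        + C (r ^ 2 * q ^ k * q ^ (k + 1)) * (X ^ 2 * linProd t r q k) := by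
      rw [linProd_succ, linProd_succ]
      simp only [C_mul, C_add, C_pow]
      ring
    simp only [← hLdef] at hrel
    rw [e1, map_sub, hL, hL] at ih1
    rw [e2, map_add, map_sub, hL, hL, hL]
    rw [ih0] at ih1 hrel ⊢
    have hd := qPoch_neg_self_ne_zero hq k
    have h1 := one_add_pow_ne_zero hq k.succ_pos
    have h2 := one_add_pow_ne_zero hq (k + 1).succ_pos
    simp only [Nat.succ_eq_add_one, pow_succ] at h1 h2
    simp only [qPoch_succ, Finset.prod_range_succ] at ih1 ⊢
    have hQ0 : q ^ k ≠ 0 := pow_ne_zero k hq0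
    simp only [pow_succ] at hrel ih1 ⊢
    generalize L (X * linProd t r q k) = a1 at *
    generalize L (_ * linProd t r q k) = a2 at *
    generalize q ^ k = Q at *
    generalize qPoch (t * r) q k = A at *
    generalize (∏ j ∈ Finset.range k, (t - r * q ^ j)) = B at *
    generalize qPoch (-q) q k = D at *
    rw [show 1 - Q * -q = 1 + Q * q by ring] at ih1 ⊢
    rw [show 1 - Q * q * -q = 1 + Q * q * q by ring]
    obtain ⟨d1, hd1⟩ : ∃ d, d = 1 + Q * q := ⟨_, rfl⟩
    obtain ⟨d2, hd2⟩ : ∃ d, d = 1 + Q * q * q := ⟨_, rfl⟩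
    rw [← hd1] at ih1 h1 ⊢
    rw [← hd2] at h2 ⊢
    -- L(X u_k) is solved from the known value L(u_{k+1}), then L(X² u_k) from the three-term
    -- relation.
    have f1 : a1 = (t * (A * B / D) - A * (1 - Q * (t * r)) * (B * (t - r * Q)) /
        (D * d1)) / (r * Q) := by
      rw [eq_div_iff (mul_ne_zero hr0 hQ0)]
      linear_combination -ih1
    have f2 : a2 = ((t * q + t * q * q + (1 + t * t) * r) * a1 -
      ((1 + t * t) * (t * q) + t * t * r * (1 - Q * q)) * (A * B / D)) /
        (r * d2) := by
      rw [eq_div_iff (mul_ne_zero hr0 h2)]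
      simp only [pow_zero, one_mul] at hrel
      rw [hd2]
      linear_combination -hrel
    rw [f2, f1]
    field_simp
    rw [hd1, hd2, ← hr]
    ring

lemma momentFunctional_linProd_mul {q t r : K} (hq0 : q ≠ 0)
    (hq : ∀ k : ℕ, 0 < k → q ^ k ≠ 1) (hr : r ^ 2 = q) (k m : ℕ) :
    momentFunctional (normRogersSzego · (t ^ 2) q) (linProd t r q k * linProd t (-r) q m) =
      qPoch (t * r) q k * (∏ j ∈ Finset.range k, (t - r * q ^ j)) *
      (qPoch (-(t * r)) q m * ∏ j ∈ Finset.range m, (t + r * q ^ j)) /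
        qPoch (-q) q (k + m) := by
  set L := momentFunctional (normRogersSzego · (t ^ 2) q) with hLdef
  have hL : ∀ a p, L (C a * p) = a * L p := momentFunctional_C_mul _
  induction m generalizing k with
  | zero => simpa [linProd_zero, qPoch] using momentFunctional_linProd hq0 hq hr k
  | succ m ih =>
    -- Eliminates `X` between the next factors: q^k (t + r q^m X) + q^m (t - r q^k X) = t (q^m +
    -- q^k).
    have e : C (q ^ k) * (linProd t r q k * linProd t (-r) q (m + 1)) =
        C (t * (q ^ m + q ^ k)) * (linProd t r q k * linProd t (-r) q m) -
        C (q ^ m) * (linProd t r q (k + 1) * linProd t (-r) q m) := by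
      simp only [linProd_succ, C_mul, C_add, C_neg, neg_mul]
      ring
    have h := congrArg L e
    rw [map_sub, hL, hL, hL, ih, ih] at h
    have hd := qPoch_neg_self_ne_zero hq (k + m)
    have h1 := one_add_pow_ne_zero hq (k + m).succ_pos
    simp only [Nat.succ_eq_add_one] at h1
    have hQ0 : q ^ k ≠ 0 := pow_ne_zero k hq0
    apply mul_left_cancel₀ hQ0
    rw [h, show k + 1 + m = k + m + 1 by ring, show k + (m + 1) = k + m + 1 by ring]
    simp only [qPoch_succ, Finset.prod_range_succ]
    rw [show 1 - q ^ (k + m) * -q = 1 + q ^ (k + m + 1) by ring]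
    obtain ⟨d, hd'⟩ : ∃ d, d = 1 + q ^ (k + m + 1) := ⟨_, rfl⟩
    rw [← hd'] at h1 ⊢
    rw [pow_succ, pow_add] at hd'
    generalize (∏ j ∈ Finset.range k, (t - r * q ^ j)) = A
    generalize (∏ j ∈ Finset.range m, (t + r * q ^ j)) = B
    generalize q ^ k = Q at *
    generalize q ^ m = R at *
    field_simp
    rw [hd', ← hr]
    ring

end MixedMoments

/-! ### The determinant of 1/(-q;q)_{i+j} -/

section ReciprocalDeterminant

open Polynomial

variable {K : Type*} [Field K]

lemma qPoch_neg_self_mul_prod (q : K) (a j : ℕ) :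
    qPoch (-q) q (a + j) = qPoch (-q) q a * ∏ l ∈ Finset.range j, (1 + q ^ (a + j - l)) := by
  induction j with
  | zero => simp
  | succ j ih =>
    rw [← add_assoc, qPoch_succ, ih, Finset.prod_range_succ', mul_assoc]
    congr 2
    · refine Finset.prod_congr rfl fun l _ => ?_
      rw [Nat.add_sub_add_right]
    · rw [Nat.sub_zero]; ring

lemma det_vandermonde_pow_rev (q : K) (n : ℕ) :
    (Matrix.vandermonde fun i : Fin (n + 1) => q ^ (n - (i : ℕ))).det =
      ∏ a ∈ Finset.range (n + 1), ∏ b ∈ Finset.range a, (q ^ b - q ^ a) := by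
  rw [Matrix.det_vandermonde]
  induction n with
  | zero => simp
  | succ n ih =>
    rw [Fin.prod_univ_succ, Fin.prod_Ioi_zero, Finset.prod_range_succ, ← ih, mul_comm]
    congr 1
    · refine Finset.prod_congr rfl fun i _ => ?_
      rw [Fin.prod_Ioi_succ]
      simp
    · rw [← Finset.prod_range_reflect, ← Fin.prod_univ_eq_prod_range
        (fun b => q ^ (n + 1 - 1 - b) - q ^ (n + 1)) (n + 1)]
      simp

lemma prod_pow_sub_pow (q : K) {n a : ℕ} (ha : a ≤ n) :
    (∏ l ∈ Finset.range a, q ^ (n - l)) * ∏ b ∈ Finset.range a, (q ^ b - q ^ a) =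
      q ^ (n * a) * qPoch q q a := by
  have h : (q ^ n) ^ a = ∏ _l ∈ Finset.range a, q ^ n := by simp
  rw [← prod_one_sub_pow_tsub, ← Finset.prod_mul_distrib, pow_mul, h, ← Finset.prod_mul_distrib]
  refine Finset.prod_congr rfl fun l hl => ?_
  have := Finset.mem_range.1 hl
  have h1 : q ^ n = q ^ (n - l) * q ^ l := by rw [← pow_add]; congr 1; omega
  have h2 : q ^ a = q ^ (a - l) * q ^ l := by rw [← pow_add]; congr 1; omega
  rw [h1, h2]
  ring

/-- After reversing rows and columns, 1/(-q;q)_{2n-i} factors out of row i and leaves ∏_{l<j} (1 +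
q^{n-l} x_i) with x_i = q^{n-i}. Taking q^{n-l} out of each factor makes column j a monic polynomial
of degree j in x_i, so the determinant is Vandermonde. -/
lemma det_inv_qPoch_neg_self {q : K} (hq0 : q ≠ 0) (hq : ∀ k : ℕ, 0 < k → q ^ k ≠ 1) (n : ℕ) :
    (Matrix.of fun i j : Fin (n + 1) => (qPoch (-q) q ((i : ℕ) + (j : ℕ)))⁻¹).det =
      q ^ (n ^ 2 * (n + 1) / 2) * (∏ j ∈ Finset.range (n + 1), qPoch q q j) /
        ∏ j ∈ Finset.range (n + 1), qPoch (-q) q (j + n) := by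
  let p : Fin (n + 1) → K[X] := fun j => ∏ l ∈ Finset.range j, (X + C (q ^ (n - l))⁻¹)
  have hp : ∀ j, (p j).Monic := fun j => monic_prod_of_monic _ _ fun l _ => monic_X_add_C _
  have hdeg : ∀ j, (p j).natDegree = j := fun j => by
    rw [natDegree_prod_of_monic _ _ fun l _ => monic_X_add_C _]
    simp
  have hentry : ((Matrix.of fun i j : Fin (n + 1) =>
      (qPoch (-q) q ((i : ℕ) + (j : ℕ)))⁻¹).submatrix Fin.revPerm Fin.revPerm) =
      Matrix.of fun i j : Fin (n + 1) => (qPoch (-q) q (n - (i : ℕ) + n))⁻¹ *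
        (Matrix.of fun i j : Fin (n + 1) => (∏ l ∈ Finset.range j, q ^ (n - l)) *
          (Matrix.of fun i j : Fin (n + 1) =>
            (p j).eval (q ^ (n - (i : ℕ)))) i j) i j := by
    ext i j
    have hi := i.is_lt
    have hj := j.is_lt
    simp only [Matrix.submatrix_apply, Matrix.of_apply, Fin.revPerm_apply, Fin.val_rev]
    have e := qPoch_neg_self_mul_prod q (n - (i : ℕ) + (n - (j : ℕ))) (j : ℕ)
    have e2 : n - (i : ℕ) + (n - (j : ℕ)) + (j : ℕ) = n - (i : ℕ) + n := by omega
    rw [e2] at e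
    have h1 := qPoch_neg_self_ne_zero hq (n - (i : ℕ) + n)
    rw [show n + 1 - ((i : ℕ) + 1) + (n + 1 - ((j : ℕ) + 1)) = n - i + (n - j) by omega,
      eq_comm, inv_mul_eq_iff_eq_mul₀ h1, e, mul_right_comm,
      mul_inv_cancel₀ (qPoch_neg_self_ne_zero hq _), one_mul, eval_prod,
      ← Finset.prod_mul_distrib]
    refine Finset.prod_congr rfl fun l hl => ?_
    have := Finset.mem_range.1 hl
    have h2 : q ^ (n - l) ≠ 0 := pow_ne_zero _ hq0
    rw [show n - (i : ℕ) + n - l = (n - l) + (n - i) by omega, pow_add]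
    simp only [eval_add, eval_X, eval_C]
    field_simp
    ring
  rw [← Matrix.det_submatrix_equiv_self Fin.revPerm, hentry, Matrix.det_mul_column,
    Matrix.det_mul_row, ← Matrix.det_eval_matrixOfPolynomials_eq_det_vandermonde _ p hdeg hp,
    det_vandermonde_pow_rev, Fin.prod_univ_eq_prod_range
      (fun j => ∏ l ∈ Finset.range j, q ^ (n - l)) (n + 1),
    ← Finset.prod_mul_distrib,
    Fin.prod_univ_eq_prod_range (fun j => (qPoch (-q) q (n - j + n))⁻¹) (n + 1),
    Finset.prod_congr rfl fun a ha => prod_pow_sub_pow q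
      (Nat.lt_succ_iff.1 (Finset.mem_range.1 ha)),
    Finset.prod_mul_distrib, Finset.prod_pow_eq_pow_sum, ← Finset.mul_sum]
  have hexp : n * ∑ i ∈ Finset.range (n + 1), i = n ^ 2 * (n + 1) / 2 := by
    have := Finset.sum_range_id_mul_two (n + 1)
    symm
    apply Nat.div_eq_of_eq_mul_left two_pos
    rw [mul_assoc, this, Nat.add_sub_cancel]
    ring
  have hrefl := Finset.prod_range_reflect (fun j => (qPoch (-q) q (j + n))⁻¹) (n + 1)
  simp only [Nat.add_sub_cancel] at hrefl
  rw [hexp, hrefl, Finset.prod_inv_distrib, div_eq_inv_mul]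

end ReciprocalDeterminant

/-! ### Change of basis in a Hankel determinant -/

section ChangeOfBasis

open Polynomial

variable {K : Type*} [Field K]

/-- The matrix is U H Vᵀ with U, V the lower triangular coefficient matrices. -/
lemma det_momentFunctional_mul (f : ℕ → K) (n : ℕ) {u v : ℕ → K[X]}
    (hu : ∀ i, (u i).natDegree ≤ i) (hv : ∀ i, (v i).natDegree ≤ i) :
    (Matrix.of fun i j : Fin (n + 1) => momentFunctional f (u i * v j)).det =
      (∏ i ∈ Finset.range (n + 1), (u i).coeff i) * (∏ i ∈ Finset.range (n + 1), (v i).coeff i) *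
        (Matrix.of fun i j : Fin (n + 1) => f ((i : ℕ) + (j : ℕ))).det := by
  have hdet : ∀ w : ℕ → K[X], (∀ i, (w i).natDegree ≤ i) →
      (Matrix.of fun i j : Fin (n + 1) => (w i).coeff j).det =
        ∏ i ∈ Finset.range (n + 1), (w i).coeff i := by
    intro w hw
    rw [Matrix.det_of_isLowerTriangular, ← Fin.prod_univ_eq_prod_range
      (fun i => (w i).coeff i) (n + 1)]
    · rfl
    · intro i j hij
      exact coeff_eq_zero_of_natDegree_lt ((hw i).trans_lt (Fin.lt_def.1 hij))
  have hmul : (Matrix.of fun i j : Fin (n + 1) => momentFunctional f (u i * v j)) =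
      (Matrix.of fun i j : Fin (n + 1) => (u i).coeff j) *
        (Matrix.of fun i j : Fin (n + 1) => f ((i : ℕ) + (j : ℕ))) *
        (Matrix.of fun i j : Fin (n + 1) => (v i).coeff j).transpose := by
    ext i j
    rw [Matrix.of_apply, momentFunctional_mul_eq_sum f ((hu i).trans_lt i.is_lt)
      ((hv j).trans_lt j.is_lt), Finset.sum_comm]
    simp only [Matrix.mul_apply, Matrix.of_apply, Matrix.transpose_apply, Finset.sum_mul]
    rw [← Fin.sum_univ_eq_sum_range (fun l => ∑ k ∈ Finset.range (n + 1),
      (u i).coeff k * f (k + l) * (v j).coeff l)]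
    refine Finset.sum_congr rfl fun l _ => ?_
    rw [← Fin.sum_univ_eq_sum_range (fun k => (u i).coeff k * f (k + l) * (v j).coeff l)]
  rw [hmul, Matrix.det_mul, Matrix.det_mul, Matrix.det_transpose, hdet u hu, hdet v hv]
  ring

lemma natDegree_linProd_le (t r q : K) (k : ℕ) : (linProd t r q k).natDegree ≤ k := by
  refine (natDegree_prod_le _ _).trans ?_
  refine (Finset.sum_le_card_nsmul _ _ 1 fun j _ => ?_).trans (by simp)
  compute_degree

lemma coeff_linProd_self (t r q : K) (k : ℕ) :
    (linProd t r q k).coeff k = ∏ j ∈ Finset.range k, -(r * q ^ j) := by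
  induction k with
  | zero => simp [linProd_zero]
  | succ k ih =>
    have h0 : (linProd t r q k).coeff (k + 1) = 0 :=
      coeff_eq_zero_of_natDegree_lt (Nat.lt_succ_of_le (natDegree_linProd_le t r q k))
    rw [linProd_succ, Finset.prod_range_succ, ← ih, mul_sub, coeff_sub, coeff_mul_C, h0,
      ← mul_assoc, coeff_mul_X, coeff_mul_C]
    ring

end ChangeOfBasis

/-! ### Evaluation, descent from the algebraic closure, and zeros -/

section Evaluation

variable {K : Type*} [Field K]

/-- The powers of `q` multiplying `s` are the odd ones from -(2k-1) to 2k-1; opposite exponents are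
paired by reflecting the first half. -/
lemma qPoch_div_zpow {q : K} (hq0 : q ≠ 0) (s : K) (k : ℕ) :
    qPoch (s / q ^ (2 * (k : ℤ) - 1)) (q ^ 2) (2 * k) =
      ∏ j ∈ Finset.range k, ((1 - q ^ (2 * j + 1) * s) * (1 - s / q ^ (2 * j + 1))) := by
  have hz : q ^ (2 * (k : ℤ) - 1) = q ^ (2 * k) / q := by
    rw [zpow_sub_one₀ hq0, div_eq_mul_inv]
    norm_cast
  rw [qPoch, two_mul k, Finset.prod_range_add, ← Finset.prod_range_reflect, mul_comm,
    ← Finset.prod_mul_distrib]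
  refine Finset.prod_congr rfl fun j hj => ?_
  have hj := Finset.mem_range.1 hj
  have h1 : q ^ (2 * k) = q ^ (2 * (k - 1 - j)) * q ^ (2 * j + 1) * q := by
    rw [← pow_add, ← pow_succ]; congr 1; omega
  have h2 : q ^ (2 * (k - 1 - j)) ≠ 0 := pow_ne_zero _ hq0
  have h3 : q ^ (2 * j + 1) ≠ 0 := pow_ne_zero _ hq0
  have h4 : q ^ (2 * k) ≠ 0 := pow_ne_zero _ hq0
  congr 2
  · rw [hz, ← pow_mul, mul_add, pow_add, pow_succ]
    field_simp
  · rw [hz, h1, ← pow_mul]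
    field_simp

lemma hankelDet_eq_of_sq {q t r : K} (hq0 : q ≠ 0) (hq : ∀ k : ℕ, 0 < k → q ^ k ≠ 1)
    (hr : r ^ 2 = q) (n : ℕ) :
    hankelDet n (t ^ 2) q =
      q ^ (n ^ 2 * (n + 1) / 2) *
        ((∏ j ∈ Finset.range (n + 1),
            qPoch (t ^ 2 / q ^ (2 * (j : ℤ) - 1)) (q ^ 2) (2 * j)) *
          ∏ j ∈ Finset.range (n + 1), qPoch q q j) /
        ∏ j ∈ Finset.range (n + 1), qPoch (-q) q (j + n) := by
  have hr0 : r ≠ 0 := by rintro rfl; simp at hr; exact hq0 hr.symm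
  let a : ℕ → K := fun k => qPoch (t * r) q k * ∏ j ∈ Finset.range k, (t - r * q ^ j)
  let b : ℕ → K := fun k => qPoch (-(t * r)) q k * ∏ j ∈ Finset.range k, (t + r * q ^ j)
  let c : ℕ → K := fun k => ∏ j ∈ Finset.range k, (-(r * q ^ j) * -(-r * q ^ j))
  have hbasis := det_momentFunctional_mul (normRogersSzego · (t ^ 2) q) n
    (natDegree_linProd_le t r q) (natDegree_linProd_le t (-r) q)
  have hprod : (Matrix.of fun i j : Fin (n + 1) =>
      momentFunctional (normRogersSzego · (t ^ 2) q) (linProd t r q i * linProd t (-r) q j)) =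
      Matrix.of fun i j : Fin (n + 1) => a i * (Matrix.of fun i j : Fin (n + 1) => b j *
        (Matrix.of fun i j : Fin (n + 1) => (qPoch (-q) q ((i : ℕ) + (j : ℕ)))⁻¹) i j) i j := by
    ext i j
    simp only [Matrix.of_apply, momentFunctional_linProd_mul hq0 hq hr, a, b]
    rw [div_eq_mul_inv]
    ring
  rw [hprod, Matrix.det_mul_column, Matrix.det_mul_row, Fin.prod_univ_eq_prod_range a,
    Fin.prod_univ_eq_prod_range b, det_inv_qPoch_neg_self hq0 hq, ← mul_assoc,
    ← Finset.prod_mul_distrib, ← Finset.prod_mul_distrib] at hbasis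
  have hc : ∀ k, (linProd t r q k).coeff k * (linProd t (-r) q k).coeff k = c k := fun k => by
    rw [coeff_linProd_self, coeff_linProd_self, ← Finset.prod_mul_distrib]
  have hc0 : ∀ k, c k ≠ 0 := fun k => Finset.prod_ne_zero_iff.2 fun j _ => by
    simp [hr0, hq0]
  -- Factor by factor, a_k b_k contributes (1 - q^{2j+1} s)(s - q^{2j+1}) and c_k contributes
  -- -q^{2j+1}.
  have hab : ∀ k, a k * b k =
      c k * qPoch (t ^ 2 / q ^ (2 * (k : ℤ) - 1)) (q ^ 2) (2 * k) := fun k => by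
    rw [qPoch_div_zpow hq0]
    simp only [a, b, c, qPoch, ← Finset.prod_mul_distrib]
    refine Finset.prod_congr rfl fun j _ => ?_
    have h1 : q ^ (2 * j + 1) = (q ^ j) ^ 2 * r ^ 2 := by rw [hr]; ring
    have h2 : q ^ j ≠ 0 := pow_ne_zero _ hq0
    rw [h1]
    field_simp
    ring
  simp only [hc, hab] at hbasis
  rw [Finset.prod_mul_distrib] at hbasis
  apply mul_left_cancel₀ (Finset.prod_ne_zero_iff.2 fun k (_ : k ∈ Finset.range (n + 1)) => hc0 k)
  rw [hankelDet, ← hbasis]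
  ring

lemma map_qPoch {F : Type*} [Field F] (φ : K →+* F) (x q : K) (n : ℕ) :
    φ (qPoch x q n) = qPoch (φ x) (φ q) n := by
  simp [qPoch]

lemma map_hankelDet {F : Type*} [Field F] (φ : K →+* F) (n : ℕ) (s q : K) :
    φ (hankelDet n s q) = hankelDet n (φ s) (φ q) := by
  rw [hankelDet, RingHom.map_det, hankelDet]
  congr 1
  ext i j
  simp [normRogersSzego, rogersSzego, qBinom, map_qPoch]

lemma hankelDet_eq {q : K} (hq0 : q ≠ 0) (hq : ∀ k : ℕ, 0 < k → q ^ k ≠ 1) (n : ℕ) (s : K) :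
    hankelDet n s q =
      q ^ (n ^ 2 * (n + 1) / 2) *
        ((∏ j ∈ Finset.range (n + 1),
            qPoch (s / q ^ (2 * (j : ℤ) - 1)) (q ^ 2) (2 * j)) *
          ∏ j ∈ Finset.range (n + 1), qPoch q q j) /
        ∏ j ∈ Finset.range (n + 1), qPoch (-q) q (j + n) := by
  let φ := algebraMap K (AlgebraicClosure K)
  obtain ⟨t, ht⟩ := IsAlgClosed.exists_pow_nat_eq (φ s) two_pos
  obtain ⟨r, hr⟩ := IsAlgClosed.exists_pow_nat_eq (φ q) two_pos
  have hφ0 : φ q ≠ 0 := (map_ne_zero φ).2 hq0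
  have hφ : ∀ k : ℕ, 0 < k → φ q ^ k ≠ 1 := fun k hk h =>
    hq k hk (φ.injective (by rw [map_pow, h, map_one]))
  apply φ.injective
  have h := hankelDet_eq_of_sq (t := t) hφ0 hφ hr n
  rw [ht] at h
  simpa only [map_hankelDet, map_div₀, map_mul, map_prod, map_pow, map_zpow₀, map_qPoch, map_neg]
    using h

lemma qPoch_div_zpow_eq_zero_iff {q : K} (hq0 : q ≠ 0) (s : K) (k : ℕ) :
    qPoch (s / q ^ (2 * (k : ℤ) - 1)) (q ^ 2) (2 * k) = 0 ↔
      ∃ m : ℕ, m < k ∧ (s = q ^ (2 * (m : ℤ) + 1) ∨ s = q ^ (-(2 * (m : ℤ) + 1))) := by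
  rw [qPoch_div_zpow hq0, Finset.prod_eq_zero_iff]
  refine exists_congr fun m => ?_
  have h0 : q ^ (2 * m + 1) ≠ 0 := pow_ne_zero _ hq0
  have hz : q ^ (2 * (m : ℤ) + 1) = q ^ (2 * m + 1) := by norm_cast
  rw [Finset.mem_range, mul_eq_zero, sub_eq_zero, sub_eq_zero, zpow_neg, hz, or_comm,
    eq_comm (a := (1 : K)), eq_comm (a := (1 : K)), div_eq_one_iff_eq h0,
    mul_comm _ s, mul_eq_one_iff_eq_inv₀ h0]

end Evaluation

theorem theorem3p1 {K : Type*} [Field K] (q : K) (hq0 : q ≠ 0)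
    (hq : ∀ k : ℕ, 0 < k → q ^ k ≠ 1) (n : ℕ) (s : K) :
    hankelDet n s q =
        q ^ (n ^ 2 * (n + 1) / 2) *
          ((∏ j ∈ Finset.range (n + 1),
              qPoch (s / q ^ (2 * (j : ℤ) - 1)) (q ^ 2) (2 * j)) *
            ∏ j ∈ Finset.range (n + 1), qPoch q q j) /
          ∏ j ∈ Finset.range (n + 1), qPoch (-q) q (j + n) ∧
      (hankelDet n s q = 0 ↔
        ∃ m : ℕ, m < n ∧
          (s = q ^ (2 * (m : ℤ) + 1) ∨ s = q ^ (-(2 * (m : ℤ) + 1)))) := by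
  refine ⟨hankelDet_eq hq0 hq n s, ?_⟩
  have h1 : ∏ j ∈ Finset.range (n + 1), qPoch q q j ≠ 0 :=
    Finset.prod_ne_zero_iff.2 fun j _ => qPoch_self_ne_zero hq j
  have h2 : ∏ j ∈ Finset.range (n + 1), qPoch (-q) q (j + n) ≠ 0 :=
    Finset.prod_ne_zero_iff.2 fun j _ => qPoch_neg_self_ne_zero hq _
  have h3 : q ^ (n ^ 2 * (n + 1) / 2) ≠ 0 := pow_ne_zero _ hq0
  rw [hankelDet_eq hq0 hq, div_eq_zero_iff, or_iff_left h2, mul_eq_zero, or_iff_right h3,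
    mul_eq_zero, or_iff_left h1, Finset.prod_eq_zero_iff]
  simp only [qPoch_div_zpow_eq_zero_iff hq0, Finset.mem_range]
  constructor
  · rintro ⟨k, hk, m, hm, h⟩
    exact ⟨m, by omega, h⟩
  · rintro ⟨m, hm, h⟩
    -- The factor with index `n` already has all the zeros of the others.
    exact ⟨n, n.lt_succ_self, m, hm, h⟩
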